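/- **Setting.** Let $\mathcal V,\mathcal W,\mathcal H_W$ be real Hilbert spaces, $\mathcal W$ continuously, injectively and densely embedded in $\mathcal H_W$; identify $\mathcal H_W$ with its dual, so that $\mathcal W\subset\mathcal H_W\subset\mathcal W'$. Let $a:\mathcal V\times\mathcal V\to\mathbb R$, $b:\mathcal W\times\mathcal W\to\mathbb R$, $c:\mathcal H_W\times\mathcal H_W\to\mathbb R$ be bounded, symmetric, coercive bilinear forms and $d:\mathcal V\times\mathcal H_W\to\mathbb R$ a bounded bilinear form. Let $\mathcal A:\mathcal V\to\mathcal V'$, $\mathcal B:\mathcal W\to\mathcal W'$, $\mathcal C:\mathcal H_W\to\mathcal H_W$, $\mathcal D:\mathcal V\to\mathcal H_W$ be the operators corresponding to $a,b,c,d$, let $\mathcal D^\star:\mathcal H_W\to\mathcal V'$ be the dual of $\mathcal D$, and let $\mathcal M:=\mathcal D\mathcal A^{-1}\mathcal D^\star$. (For linear poroelasticity, $\mathcal V=H_0^1(\Omega)^d$, $\mathcal W=H^1_0(\Omega)$, $\mathcal H_W=L^2(\Omega)$.) No condition on the coupling strength is imposed. Let $T>0$, $q\in\{4,5,6\}$,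 $f:[0,T]\to\mathcal V'$, $g:[0,T]\to\mathcal W'$, and let $p:[0,T]\to\mathcal W$ be a solution of $$(\mathcal M+\mathcal C)p_t+\mathcal B p=g-\mathcal D\mathcal A^{-1}f_t\quad\text{in }\mathcal W',\ t\in(0,T],$$ sufficiently regular in the sense that $p\in C^{q+1}([0,T];\mathcal H_W)$ and $f\in C^{q+1}([0,T];\mathcal V')$. Let $\alpha_0,\dots,\alpha_q$ be the coefficients of the $q$-step BDF method, $\sum_{i=0}^q\alpha_i\zeta^i=\sum_{j=1}^q\frac1j\zeta^{q-j}(\zeta-1)^j$. **Theorem 7.1 (Error estimates for fully implicit schemes).** For every constant $C_0$ there is a constant $C>0$, depending only on $q$, $T$, the spaces and forms, $f$, $g$, $p$ and $C_0$, such that the following holds for every integer $N\ge q$, with $\tau:=T/N$ and $t_n:=n\tau$. Let $p^0,\dots,p^N\in\mathcal W$ satisfy the fully implicit $q$-step BDF scheme $$(\mathcal M+\mathcal C)\sum_{i=0}^q\alpha_i p^{n-q+i}+\tau\mathcal B p^n=\tau g(t_n)-\mathcal D\mathcal A^{-1}\sum_{i=0}^q\alpha_i f(t_{n-q+i})\quad\text{in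 }\mathcal W',\qquad n=q,\dots,N,$$ with starting approximations such that $$\|p(t_j)-p^j\|_{\mathcal H_W}\le C_0\tau^q,\quad j=0,\dots,q-1,\qquad\text{and}\qquad \tau^{1/2}\|p(t_j)-p^j\|_{\mathcal W}\le C_0\tau^q,\quad 3\le j\le q-1$$ (that is, $j=3,4,5$ for $q=6$; $j=3,4$ for $q=5$; $j=3$ for $q=4$). Then $$\|p(t_n)-p^n\|_{\mathcal H_W}\le C\tau^q,\qquad n=q,\dots,N.$$ -/

import Mathlib

noncomputable section

/-- The polynomial `α(ζ) = ∑_{j=1}^q (1/j) ζ^{q-j} (ζ-1)^j` generating the implicit `q`-step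
BDF method; its coefficients are the weights `α_0, …, α_q`. -/
def bdfPoly (q : ℕ) : Polynomial ℝ :=
  ∑ j ∈ Finset.Icc 1 q,
    Polynomial.C (1 / (j : ℝ)) * Polynomial.X ^ (q - j) * (Polynomial.X - 1) ^ j

/-- The data of a linear elliptic-parabolic system: the dense continuous embedding `ι` of the
Hilbert space `W` into the Hilbert space `H`, the bounded symmetric coercive bilinear forms
`a` on `V`, `b` on `W`, `c` on `H`, and the bounded coupling form `d` on `V × H`. -/
structure EllipticParabolicSystem
    (V W H : Type*)
    [NormedAddCommGroup V] [InnerProductSpace ℝ V] [CompleteSpace V]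
    [NormedAddCommGroup W] [InnerProductSpace ℝ W] [CompleteSpace W]
    [NormedAddCommGroup H] [InnerProductSpace ℝ H] [CompleteSpace H] where
  ι : W →L[ℝ] H
  ι_injective : Function.Injective ι
  ι_denseRange : DenseRange ι
  a : V →L[ℝ] V →L[ℝ] ℝ
  b : W →L[ℝ] W →L[ℝ] ℝ
  c : H →L[ℝ] H →L[ℝ] ℝ
  d : V →L[ℝ] H →L[ℝ] ℝ
  a_symm : ∀ u v, a u v = a v u
  b_symm : ∀ p w, b p w = b w p
  c_symm : ∀ p w, c p w = c w p
  a_coercive : IsCoercive a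
  b_coercive : IsCoercive b
  c_coercive : IsCoercive c

namespace EllipticParabolicSystem

variable {V W H : Type*}
  [NormedAddCommGroup V] [InnerProductSpace ℝ V] [CompleteSpace V]
  [NormedAddCommGroup W] [InnerProductSpace ℝ W] [CompleteSpace W]
  [NormedAddCommGroup H] [InnerProductSpace ℝ H] [CompleteSpace H]
  (S : EllipticParabolicSystem V W H)

/-- The embedding `H ≅ H' → W'` of the Gelfand triple `(W, H, W')`. -/
def toWDual (h : H) : StrongDual ℝ W := (innerSL ℝ h).comp S.ι

@[simp] theorem toWDual_apply (h : H) (w : W) : S.toWDual h w = inner ℝ h (S.ι w) := rfl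

/-- The inverse `𝒜⁻¹ : V' → V` of the operator `𝒜 : V → V'`, `𝒜 u = a(u, ·)`. -/
def opAinv (φ : StrongDual ℝ V) : V :=
  S.a_coercive.continuousLinearEquivOfBilin.symm ((InnerProductSpace.toDual ℝ V).symm φ)

theorem a_opAinv (φ : StrongDual ℝ V) : S.a (S.opAinv φ) = φ := by
  ext v
  rw [← S.a_coercive.continuousLinearEquivOfBilin_apply, opAinv,
    ContinuousLinearEquiv.apply_symm_apply, InnerProductSpace.toDual_symm_apply]

theorem opAinv_a (u : V) : S.opAinv (S.a u) = u := by
  have h := S.a_opAinv (S.a u)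
  obtain ⟨k, hk, hc⟩ := S.a_coercive
  have h0 := hc (S.opAinv (S.a u) - u)
  have hz : S.a (S.opAinv (S.a u) - u) = 0 := by rw [map_sub, h, sub_self]
  rw [hz, ContinuousLinearMap.zero_apply] at h0
  have h1 : ‖S.opAinv (S.a u) - u‖ = 0 := by
    by_contra hne
    have : 0 < ‖S.opAinv (S.a u) - u‖ := lt_of_le_of_ne (norm_nonneg _) (Ne.symm hne)
    have : 0 < k * ‖S.opAinv (S.a u) - u‖ * ‖S.opAinv (S.a u) - u‖ := by positivity
    linarith
  exact sub_eq_zero.mp (norm_eq_zero.mp h1)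

/-- The operator `𝒞 : H → H` of the form `c`. -/
def opC (p : H) : H := (InnerProductSpace.toDual ℝ H).symm (S.c p)

@[simp] theorem inner_opC (p w : H) : inner ℝ (S.opC p) w = S.c p w := by
  rw [opC, InnerProductSpace.toDual_symm_apply]

/-- The operator `𝒟 : V → H` of the coupling form `d`. -/
def opD (u : V) : H := (InnerProductSpace.toDual ℝ H).symm (S.d u)

@[simp] theorem inner_opD (u : V) (w : H) : inner ℝ (S.opD u) w = S.d u w := by
  rw [opD, InnerProductSpace.toDual_symm_apply]

/-- The dual operator `𝒟⋆ : H → V'`. -/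
def opDstar (p : H) : StrongDual ℝ V := S.d.flip p

@[simp] theorem opDstar_apply (p : H) (v : V) : S.opDstar p v = S.d v p := rfl

/-- The operator `ℳ = 𝒟 𝒜⁻¹ 𝒟⋆ : H → H`. -/
def opM (p : H) : H := S.opD (S.opAinv (S.opDstar p))

/-- The operator `ℬ : W → W'` of the form `b`. -/
def opB (p : W) : StrongDual ℝ W := S.b p

/-- `p : [0,T] → W` solves `(ℳ + 𝒞) p_t + ℬ p = g - 𝒟 𝒜⁻¹ f_t` in `W'` on `(0,T]`; the time
derivatives on `[0,T]` are those of `p` as an `H`-valued function and of `f : [0,T] → V'`. -/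
def IsSolution (T : ℝ) (f : ℝ → StrongDual ℝ V) (g : ℝ → StrongDual ℝ W) (p : ℝ → W) : Prop :=
  DifferentiableOn ℝ (fun t => S.ι (p t)) (Set.Icc 0 T) ∧
  DifferentiableOn ℝ f (Set.Icc 0 T) ∧
  ∀ t ∈ Set.Ioc 0 T,
    S.toWDual (S.opM (derivWithin (fun s => S.ι (p s)) (Set.Icc 0 T) t)
        + S.opC (derivWithin (fun s => S.ι (p s)) (Set.Icc 0 T) t))
      + S.opB (p t)
    = g t - S.toWDual (S.opD (S.opAinv (derivWithin f (Set.Icc 0 T) t)))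

/-- The values `P 0, …, P N` satisfy the fully implicit `q`-step BDF scheme with time step `τ`
and nodes `t_n = n τ`: for `n = q, …, N`, in `W'`,
`(ℳ + 𝒞) ∑ α_i p^{n-q+i} + τ ℬ p^n = τ g^n - 𝒟 𝒜⁻¹ ∑ α_i f^{n-q+i}`. -/
def IsImplicitBDF (q N : ℕ) (τ : ℝ) (f : ℝ → StrongDual ℝ V) (g : ℝ → StrongDual ℝ W)
    (P : ℕ → W) : Prop :=
  ∀ n : ℕ, q ≤ n → n ≤ N →
    S.toWDual
        (S.opM (∑ i ∈ Finset.range (q + 1), (bdfPoly q).coeff i • S.ι (P (n - q + i)))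
          + S.opC (∑ i ∈ Finset.range (q + 1), (bdfPoly q).coeff i • S.ι (P (n - q + i))))
      + τ • S.opB (P n)
    = τ • g (n * τ)
      - S.toWDual (S.opD (S.opAinv
          (∑ i ∈ Finset.range (q + 1), (bdfPoly q).coeff i • f (((n - q + i : ℕ) : ℝ) * τ))))

end EllipticParabolicSystem

end

/-! Whatever the size of `d`, the form k = ⟨(ℳ + 𝒞)·, ·⟩ is symmetric and dominates the coercive
form c. The scheme is therefore a BDF method for a symmetric parabolic problem with two positive
forms, k and b, and the energy technique applies without a condition on the coupling.

Test the error equation with a fixed combination ∑ ν_i e^{n-q+i}. For suitable ν, both k(∑ α_i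
e^{n-q+i}, ∑ ν_i e^{n-q+i}) and b(e^n, ∑ ν_i e^{n-q+i}) bound from above the increment of a
quadratic form in q consecutive errors, with matrices G and K respectively. Summation telescopes:
the final G-form controls ε k(e^n, e^n), the final K-form is nonnegative and is dropped, and only
starting values and residuals remain (`EnergyMultiplier.energy_le`). Since K involves only positions
from 3 on, only those starting errors are needed in the W-norm, with the weight τ^{1/2}.

The inequalities for G and K are scalar, certified by explicit sums of squares, and pass to the
forms k and b through Gram matrices (`IsStorage.gramForm_sub_le`). The residual has size τ^{q+1}
against the H-norm of the test function (`exists_error_equation_bound`). Bounding all errors by the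
largest one leaves a quadratic inequality for that maximum, so no Gronwall argument is needed. -/

open Finset

/-! ### Multipliers and storage functions. -/

/-- The quadratic form with coefficient matrix `G` in the variables `x_0, …, x_{n-1}`. -/
def coeffForm {n : ℕ} (G : Fin n → Fin n → ℝ) (x : Fin n → ℝ) : ℝ :=
  ∑ i, ∑ j, G i j * (x i * x j)

/-- The quadratic form of `G` is a storage function for the product of the linear forms `β`
and `ν`: along the shift `(x_0, …, x_{q-1}) ↦ (x_1, …, x_q)` it grows at most by
`(∑ β_i x_i) (∑ ν_i x_i)`. -/
def IsStorage {q : ℕ} (β ν : Fin (q + 1) → ℝ) (G : Fin q → Fin q → ℝ) : Prop :=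
  ∀ x : Fin (q + 1) → ℝ, coeffForm G (fun i => x i.succ) - coeffForm G (fun i => x i.castSucc)
    ≤ (∑ i, β i * x i) * ∑ i, ν i * x i

/-- A multiplier `ν` for the `q`-step method with weights `α`, together with the storage functions
`G` (for the difference quotient) and `K` (for the implicit term) of the energy technique. -/
structure EnergyMultiplier (q : ℕ) (α : Fin (q + 1) → ℝ) where
  ν : Fin (q + 1) → ℝ
  G : Fin q → Fin q → ℝ
  K : Fin q → Fin q → ℝ
  ε : ℝ
  ε_pos : 0 < ε
  le_G : ∀ x : Fin (q + 1) → ℝ, ε * x (Fin.last q) ^ 2 ≤ coeffForm G (fun i => x i.succ)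
  K_nonneg : ∀ x : Fin (q + 1) → ℝ, 0 ≤ coeffForm K (fun i => x i.succ)
  K_support : ∀ i j, K i j ≠ 0 → 3 ≤ (i : ℕ) ∧ 3 ≤ (j : ℕ)
  storage_G : IsStorage α ν G
  storage_K : IsStorage (Pi.single (Fin.last q) 1) ν K

/-! ### BDF weights and their order conditions. -/

theorem bdfPoly_four :
    bdfPoly 4 = Polynomial.C (1 / 12 : ℝ) *
      (Polynomial.C 3 - Polynomial.C 16 * Polynomial.X + Polynomial.C 36 * Polynomial.X ^ 2
        - Polynomial.C 48 * Polynomial.X ^ 3 + Polynomial.C 25 * Polynomial.X ^ 4) := by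
  refine Polynomial.funext fun x => ?_
  simp [bdfPoly, Finset.sum_Icc_succ_top]
  ring

theorem bdfPoly_five :
    bdfPoly 5 = Polynomial.C (1 / 60 : ℝ) *
      (- Polynomial.C 12 + Polynomial.C 75 * Polynomial.X - Polynomial.C 200 * Polynomial.X ^ 2
        + Polynomial.C 300 * Polynomial.X ^ 3 - Polynomial.C 300 * Polynomial.X ^ 4
        + Polynomial.C 137 * Polynomial.X ^ 5) := by
  refine Polynomial.funext fun x => ?_
  simp [bdfPoly, Finset.sum_Icc_succ_top]
  ring

theorem bdfPoly_six :
    bdfPoly 6 = Polynomial.C (1 / 60 : ℝ) *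
      (Polynomial.C 10 - Polynomial.C 72 * Polynomial.X + Polynomial.C 225 * Polynomial.X ^ 2
        - Polynomial.C 400 * Polynomial.X ^ 3 + Polynomial.C 450 * Polynomial.X ^ 4
        - Polynomial.C 360 * Polynomial.X ^ 5 + Polynomial.C 147 * Polynomial.X ^ 6) := by
  refine Polynomial.funext fun x => ?_
  simp [bdfPoly, Finset.sum_Icc_succ_top]
  ring

/-- The weights of the `q`-step BDF method. -/
noncomputable def bdfWeight (q : ℕ) (i : Fin (q + 1)) : ℝ := (bdfPoly q).coeff i

theorem bdfWeight_four : bdfWeight 4 = ![3 / 12, -16 / 12, 36 / 12, -48 / 12, 25 / 12] := by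
  funext i
  rw [bdfWeight, bdfPoly_four]
  fin_cases i <;> simp [Polynomial.coeff_X, Polynomial.coeff_C, Polynomial.coeff_X_pow] <;> norm_num

theorem bdfWeight_five :
    bdfWeight 5 = ![-12 / 60, 75 / 60, -200 / 60, 300 / 60, -300 / 60, 137 / 60] := by
  funext i
  rw [bdfWeight, bdfPoly_five]
  fin_cases i <;> simp [Polynomial.coeff_X, Polynomial.coeff_C, Polynomial.coeff_X_pow] <;> norm_num

theorem bdfWeight_six :
    bdfWeight 6 = ![10 / 60, -72 / 60, 225 / 60, -400 / 60, 450 / 60, -360 / 60, 147 / 60] := by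
  funext i
  rw [bdfWeight, bdfPoly_six]
  fin_cases i <;> simp [Polynomial.coeff_X, Polynomial.coeff_C, Polynomial.coeff_X_pow] <;> norm_num

/-- The BDF weights integrate the powers `x ^ k`, `k ≤ q`, exactly. -/
theorem sum_bdfWeight_mul_pow {q : ℕ} (hq : q = 4 ∨ q = 5 ∨ q = 6) {k : ℕ} (hk : k ≤ q) :
    ∑ i : Fin (q + 1), bdfWeight q i * ((i : ℕ) : ℝ) ^ k = k * (q : ℝ) ^ (k - 1) := by
  obtain rfl | rfl | rfl := hq
  · rw [bdfWeight_four]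
    interval_cases k <;> simp [Fin.sum_univ_succ] <;> norm_num
  · rw [bdfWeight_five]
    interval_cases k <;> simp [Fin.sum_univ_succ] <;> norm_num
  · rw [bdfWeight_six]
    interval_cases k <;> simp [Fin.sum_univ_succ] <;> norm_num

/-! ### Explicit multipliers for q = 4, 5, 6. -/

/-- The test function is a multiple of e^n - (1/2) e^{n-1}. Each inequality is an identity
exhibiting the slack as a weighted sum of squares. In `storage_G` only differences of the variables
occur: since the weights sum to zero, the slack vanishes on constant sequences. -/
noncomputable def energyMultiplierFour : EnergyMultiplier 4 (bdfWeight 4) where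
  ν := ![0, 0, 0, -12, 24]
  G := ![![6, -12, 12, -15 / 2],
      ![-12, 34, -42, 53 / 2],
      ![12, -42, 70, -103 / 2],
      ![-15 / 2, 53 / 2, -103 / 2, 45]]
  K := ![![0, 0, 0, 0], ![0, 0, 0, 0], ![0, 0, 0, 0], ![0, 0, 0, 12]]
  ε := 4
  ε_pos := by norm_num
  le_G x := by
    simp [coeffForm, Fin.sum_univ_succ]
    linear_combination (3/8) * sq_nonneg (4 * (x 2 - x 1) - 4 * (x 3 - x 2) + 4 * (x 4 - x 3) +
      x 4) +
      (1/40) * sq_nonneg (20 * (x 3 - x 2) - 16 * (x 4 - x 3) - 7 * x 4) +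
      (1/340) * sq_nonneg (68 * (x 4 - x 3) + 11 * x 4) +
      (3/68) * sq_nonneg (x 4)
  K_nonneg x := by
    simp [coeffForm, Fin.sum_univ_succ]
    linear_combination sq_nonneg (x 4)
  K_support i j := by fin_cases i <;> fin_cases j <;> simp
  storage_G x := by
    rw [bdfWeight_four]
    simp [coeffForm, Fin.sum_univ_succ]
    linear_combination (3/2) * sq_nonneg (2 * (x 1 - x 0) - 2 * (x 2 - x 1) + 2 * (x 3 - x 2) -
      (x 4 - x 3)) +
      (1/16) * sq_nonneg (8 * (x 2 - x 1) - 4 * (x 3 - x 2) + 5 * (x 4 - x 3)) +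
      (1/48) * sq_nonneg (12 * (x 3 - x 2) + (x 4 - x 3)) +
      (23/12) * sq_nonneg (x 4 - x 3)
  storage_K x := by
    simp [coeffForm, Fin.sum_univ_succ, Pi.single_apply]
    linear_combination 6 * sq_nonneg (x 4 - x 3) + 6 * sq_nonneg (x 4) + 6 * sq_nonneg (x 3)

/-- The test function is a multiple of e^n - (9/10) e^{n-1}; as it reaches back one step only, K
needs just the last position of the window. -/
noncomputable def energyMultiplierFive : EnergyMultiplier 5 (bdfWeight 5) where
  ν := ![0, 0, 0, 0, -540, 600]
  G := ![![255, -420, 450, -480, 201],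
      ![-420, 1080, -1350, 1395, -1473 / 2],
      ![450, -1350, 2190, -2460, 2477 / 2],
      ![-480, 1395, -2460, 3345, -3763 / 2],
      ![201, -1473 / 2, 2477 / 2, -3763 / 2, 1247]]
  K := ![![0, 0, 0, 0, 0], ![0, 0, 0, 0, 0], ![0, 0, 0, 0, 0], ![0, 0, 0, 0, 0], ![0, 0, 0, 0, 300]]
  ε := 27
  ε_pos := by norm_num
  le_G x := by
    simp [coeffForm, Fin.sum_univ_succ]
    linear_combination (3/85) * sq_nonneg (85 * (x 2 - x 1) - 55 * (x 3 - x 2) + 95 * (x 4 - x 3) -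
      65 * (x 5 - x 4) - 2 * x 5) +
      (3/5984) * sq_nonneg (880 * (x 3 - x 2) - 500 * (x 4 - x 3) + 870 * (x 5 - x 4) + 49 * x 5) +
      (1/3416160) * sq_nonneg (38820 * (x 4 - x 3) - 19710 * (x 5 - x 4) - 2113 * x 5) +
      (1/833368350) * sq_nonneg (644025 * (x 5 - x 4) + 451 * x 5) +
      (1792523/5152200) * sq_nonneg (x 5)
  K_nonneg x := by
    simp [coeffForm, Fin.sum_univ_succ]
    linear_combination sq_nonneg (x 5)
  K_support i j := by fin_cases i <;> fin_cases j <;> simp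
  storage_G x := by
    rw [bdfWeight_five]
    simp [coeffForm, Fin.sum_univ_succ]
    linear_combination (15/17) * sq_nonneg (17 * (x 1 - x 0) - 11 * (x 2 - x 1) + 19 * (x 3 -
      x 2) - 13 * (x 4 - x 3) + 4 * (x 5 - x 4)) +
      (3/12835) * sq_nonneg (755 * (x 2 - x 1) - 315 * (x 3 - x 2) + 560 * (x 4 - x 3) -
        426 * (x 5 - x 4)) +
      (5/880632) * sq_nonneg (2916 * (x 3 - x 2) + 252 * (x 4 - x 3) + 3085 * (x 5 - x 4)) +
      (1/845640) * sq_nonneg (5220 * (x 4 - x 3) - 2393 * (x 5 - x 4)) +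
      (44293/7830) * sq_nonneg (x 5 - x 4)
  storage_K x := by
    simp [coeffForm, Fin.sum_univ_succ, Pi.single_apply]
    linear_combination 270 * sq_nonneg (x 5 - x 4) + 30 * sq_nonneg (x 5) + 30 * sq_nonneg (x 4)

/-- The test function is a multiple of e^n - (13/9) e^{n-1} + (25/36) e^{n-2} - (1/9) e^{n-3}. It
reaches back three steps, so K lives on positions 3, 4, 5 of the window. -/
noncomputable def energyMultiplierSix : EnergyMultiplier 6 (bdfWeight 6) where
  ν := ![0, 0, 0, -240, 1500, -3120, 2160]
  G := ![![1035, -2190, 2610, -2820, 1995, -655],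
      ![-2190, 6180, -8730, 9585, -7575, 2885],
      ![2610, -8730, 15060, -18090, 14820, -12155 / 2],
      ![-2820, 9585, -18090, 24450, -21210, 17355 / 2],
      ![1995, -7575, 14820, -21210, 20805, -18735 / 2],
      ![-655, 2885, -12155 / 2, 17355 / 2, -18735 / 2, 4905]]
  K := ![![0, 0, 0, 0, 0, 0], ![0, 0, 0, 0, 0, 0], ![0, 0, 0, 0, 0, 0],
      ![0, 0, 0, 270, -390, 360],
      ![0, 0, 0, -390, 1080, -1170],
      ![0, 0, 0, 360, -1170, 1890]]
  ε := 132
  ε_pos := by norm_num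
  le_G x := by
    simp [coeffForm, Fin.sum_univ_succ]
    linear_combination (5/207) * sq_nonneg (207 * (x 2 - x 1) - 231 * (x 3 - x 2) + 291 * (x 4 -
      x 3) - 273 * (x 5 - x 4) + 126 * (x 6 - x 5) + 5 * x 6) +
      (5/1472184) * sq_nonneg (21336 * (x 3 - x 2) - 22926 * (x 4 - x 3) + 27003 * (x 5 - x 4) -
        19278 * (x 6 - x 5) - 1409 * x 6) +
      (5/4614102024) * sq_nonneg (1297554 * (x 4 - x 3) - 1172433 * (x 5 - x 4) + 841554 * (x 6 -
        x 5) + 94337 * x 6) +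
      (15/84244977163424) * sq_nonneg (97388984 * (x 5 - x 4) - 48842640 * (x 6 - x 5) -
        1900457 * x 6) +
      (5/29636520138144) * sq_nonneg (93727728 * (x 6 - x 5) + 472573 * x 6) +
      (1187092369/3608517528) * sq_nonneg (x 6)
  K_nonneg x := by
    simp [coeffForm, Fin.sum_univ_succ]
    linear_combination (60/18) * sq_nonneg (9 * x 4 - 13 * x 5 + 12 * x 6) +
      (300/558) * sq_nonneg (31 * x 5 - 39 * x 6) +
      (60*306/31) * sq_nonneg (x 6)
  K_support i j := by fin_cases i <;> fin_cases j <;> simp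
  storage_G x := by
    rw [bdfWeight_six]
    simp [coeffForm, Fin.sum_univ_succ]
    linear_combination (5/207) * sq_nonneg (207 * (x 1 - x 0) - 231 * (x 2 - x 1) + 291 * (x 3 -
      x 2) - 277 * (x 4 - x 3) + 147 * (x 5 - x 4) - 36 * (x 6 - x 5)) +
      (1/2433285) * sq_nonneg (35265 * (x 2 - x 1) - 34935 * (x 3 - x 2) + 41636 * (x 4 - x 3) -
        39039 * (x 5 - x 4) + 17949 * (x 6 - x 5)) +
      (5/1207135056) * sq_nonneg (256728 * (x 3 - x 2) - 156292 * (x 4 - x 3) + 195369 * (x 5 -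
        x 4) - 181742 * (x 6 - x 5)) +
      (1/33378727109760) * sq_nonneg (52006368 * (x 4 - x 3) + 11888793 * (x 5 - x 4) +
        30069772 * (x 6 - x 5)) +
      (5/26329788359574912) * sq_nonneg (379710063 * (x 5 - x 4) + 64562276 * (x 6 - x 5)) +
      (89008921145/1518840252) * sq_nonneg (x 6 - x 5)
  storage_K x := by
    simp [coeffForm, Fin.sum_univ_succ, Pi.single_apply]
    linear_combination (60/18) * sq_nonneg (9 * x 3 - 13 * x 4 + 12 * x 5 - 4 * x 6) +
      (60/1332) * sq_nonneg (74 * x 4 - 78 * x 5 + 65 * x 6) +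
      (60/5106) * sq_nonneg (69 * x 5 - 2 * x 6) +
      (60*121/276) * sq_nonneg (x 6)

theorem nonempty_energyMultiplier {q : ℕ} (hq : q = 4 ∨ q = 5 ∨ q = 6) :
    Nonempty (EnergyMultiplier q (bdfWeight q)) := by
  obtain rfl | rfl | rfl := hq
  exacts [⟨energyMultiplierFour⟩, ⟨energyMultiplierFive⟩, ⟨energyMultiplierSix⟩]

/-! ### From scalar inequalities to positive semidefinite forms. -/

section GramForm

variable {E : Type*} [AddCommGroup E] [Module ℝ E]

/-- The value of the quadratic form with coefficients `G` on the Gram matrix of `u` with respect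
to `B`. -/
def gramForm (B : E →ₗ[ℝ] E →ₗ[ℝ] ℝ) {n : ℕ} (G : Fin n → Fin n → ℝ) (u : Fin n → E) : ℝ :=
  ∑ i, ∑ j, G i j * B (u i) (u j)

/-- The Gram matrix of a positive semidefinite form is a sum of rank-one matrices. -/
theorem exists_gram_eq_sum_mul {B : E →ₗ[ℝ] E →ₗ[ℝ] ℝ} (hsymm : ∀ x y, B x y = B y x)
    (hnonneg : ∀ x, 0 ≤ B x x) {n : ℕ} (u : Fin n → E) :
    ∃ (m : ℕ) (c : Fin m → Fin n → ℝ), ∀ i j, B (u i) (u j) = ∑ k, c k i * c k j := by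
  have hpos : (Matrix.of fun i j => B (u i) (u j)).PosSemidef := by
    refine Matrix.PosSemidef.of_dotProduct_mulVec_nonneg ?_ fun x => ?_
    · ext i j
      simp [hsymm (u j) (u i)]
    · refine (hnonneg (∑ i, x i • u i)).trans_eq ?_
      simp [dotProduct, Matrix.mulVec, map_sum, Finset.mul_sum, LinearMap.sum_apply]
      exact sum_congr rfl fun i _ => sum_congr rfl fun j _ => by rw [hsymm (u j) (u i)]; ring
  obtain ⟨m, c, hc⟩ := Matrix.posSemidef_iff_eq_sum_vecMulVec.mp hpos
  refine ⟨m, c, fun i j => ?_⟩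
  have := congrFun (congrFun hc i) j
  simpa [Matrix.sum_apply, Matrix.vecMulVec_apply] using this

theorem gramForm_eq_sum_coeffForm {B : E →ₗ[ℝ] E →ₗ[ℝ] ℝ} {n m : ℕ} (G : Fin n → Fin n → ℝ)
    (u : Fin n → E) (c : Fin m → Fin n → ℝ) (h : ∀ i j, B (u i) (u j) = ∑ k, c k i * c k j) :
    gramForm B G u = ∑ k, coeffForm G (c k) := by
  simp only [gramForm, coeffForm, h, Finset.mul_sum]
  exact (sum_congr rfl fun i _ => sum_comm).trans sum_comm

theorem mul_le_gramForm {B : E →ₗ[ℝ] E →ₗ[ℝ] ℝ} (hsymm : ∀ x y, B x y = B y x)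
    (hnonneg : ∀ x, 0 ≤ B x x) {q : ℕ} {G : Fin q → Fin q → ℝ} {ε : ℝ}
    (hG : ∀ x : Fin (q + 1) → ℝ, ε * x (Fin.last q) ^ 2 ≤ coeffForm G (fun i => x i.succ))
    (u : Fin (q + 1) → E) :
    ε * B (u (Fin.last q)) (u (Fin.last q)) ≤ gramForm B G (fun i => u i.succ) := by
  obtain ⟨m, c, hc⟩ := exists_gram_eq_sum_mul hsymm hnonneg u
  rw [gramForm_eq_sum_coeffForm G _ (fun k i => c k i.succ) (fun i j => hc _ _), hc, mul_sum]
  refine sum_le_sum fun k _ => ?_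
  simpa [sq] using hG (c k)

/-- Write the Gram matrix as a sum of rank-one matrices c_k c_kᵀ. Both sides are linear in the Gram
matrix, so the claim is the sum over k of the scalar inequality at x = c_k. -/
theorem IsStorage.gramForm_sub_le {B : E →ₗ[ℝ] E →ₗ[ℝ] ℝ} (hsymm : ∀ x y, B x y = B y x)
    (hnonneg : ∀ x, 0 ≤ B x x) {q : ℕ} {β ν : Fin (q + 1) → ℝ} {G : Fin q → Fin q → ℝ}
    (hG : IsStorage β ν G) (u : Fin (q + 1) → E) :
    gramForm B G (fun i => u i.succ) - gramForm B G (fun i => u i.castSucc)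
      ≤ B (∑ i, β i • u i) (∑ i, ν i • u i) := by
  obtain ⟨m, c, hc⟩ := exists_gram_eq_sum_mul hsymm hnonneg u
  rw [gramForm_eq_sum_coeffForm G _ (fun k i => c k i.succ) (fun i j => hc _ _),
    gramForm_eq_sum_coeffForm G _ (fun k i => c k i.castSucc) (fun i j => hc _ _),
    ← sum_sub_distrib]
  refine (sum_le_sum fun k _ => hG (c k)).trans_eq ?_
  have h : ∀ k, (∑ i, β i * c k i) * ∑ i, ν i * c k i
      = ∑ i, ∑ j, β i * ν j * (c k i * c k j) := fun k => by
    rw [Finset.sum_mul_sum]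
    exact sum_congr rfl fun i _ => sum_congr rfl fun j _ => by ring
  simp only [h, map_sum, map_smul, LinearMap.sum_apply, LinearMap.smul_apply, smul_eq_mul, hc,
    mul_sum]
  refine (sum_comm.trans ((sum_congr rfl fun i _ => sum_comm).trans sum_comm)).trans ?_
  exact sum_congr rfl fun j _ => sum_congr rfl fun i _ => sum_congr rfl fun k _ => by ring

end GramForm

/-! ### Energy stability. -/

section Stability

variable {W H : Type*} [AddCommGroup W] [Module ℝ W] [NormedAddCommGroup H] [NormedSpace ℝ H]

theorem norm_sum_smul_le_of_forall_norm_le {n : ℕ} (ν : Fin n → ℝ) (u : Fin n → H) {M : ℝ}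
    (hu : ∀ i, ‖u i‖ ≤ M) : ‖∑ i, ν i • u i‖ ≤ (∑ i, |ν i|) * M := by
  refine (norm_sum_le _ _).trans ?_
  rw [sum_mul]
  refine sum_le_sum fun i _ => ?_
  rw [norm_smul, Real.norm_eq_abs]
  exact mul_le_mul_of_nonneg_left (hu i) (abs_nonneg _)

/-- One step of the energy technique. -/
theorem EnergyMultiplier.gramForm_succ_le {q : ℕ} {α : Fin (q + 1) → ℝ}
    (μ : EnergyMultiplier q α) {k : H →ₗ[ℝ] H →ₗ[ℝ] ℝ} {b : W →ₗ[ℝ] W →ₗ[ℝ] ℝ}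
    (ι : W →ₗ[ℝ] H)
    (hk : ∀ x y, k x y = k y x) (hk0 : ∀ x, 0 ≤ k x x)
    (hb : ∀ x y, b x y = b y x) (hb0 : ∀ x, 0 ≤ b x x) {τ ρ : ℝ} (hτ : 0 ≤ τ)
    (u : Fin (q + 1) → W)
    (hu : ∀ w, k (∑ i, α i • ι (u i)) (ι w) + τ * b (u (Fin.last q)) w ≤ ρ * ‖ι w‖) :
    gramForm k μ.G (fun i => ι (u i.succ)) + τ * gramForm b μ.K (fun i => u i.succ)
      ≤ gramForm k μ.G (fun i => ι (u i.castSucc)) + τ * gramForm b μ.K (fun i => u i.castSucc)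
        + ρ * ‖∑ i, μ.ν i • ι (u i)‖ := by
  have h1 := μ.storage_G.gramForm_sub_le hk hk0 (fun i => ι (u i))
  have h2 := mul_le_mul_of_nonneg_left (μ.storage_K.gramForm_sub_le hb hb0 u) hτ
  have h3 := hu (∑ i, μ.ν i • u i)
  have h4 : (∑ i, (Pi.single (Fin.last q) 1 : Fin (q + 1) → ℝ) i • u i) = u (Fin.last q) := by
    simp [Pi.single_apply]
  rw [h4] at h2
  have h5 : ι (∑ i, μ.ν i • u i) = ∑ i, μ.ν i • ι (u i) := by simp
  rw [h5] at h3
  linarith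

/-- The energy estimate for a multistep method that admits a multiplier. -/
theorem EnergyMultiplier.energy_le {q : ℕ} {α : Fin (q + 1) → ℝ}
    (μ : EnergyMultiplier q α) {k : H →ₗ[ℝ] H →ₗ[ℝ] ℝ} {b : W →ₗ[ℝ] W →ₗ[ℝ] ℝ}
    (ι : W →ₗ[ℝ] H)
    (hk : ∀ x y, k x y = k y x) (hk0 : ∀ x, 0 ≤ k x x)
    (hb : ∀ x y, b x y = b y x) (hb0 : ∀ x, 0 ≤ b x x) {τ ρ M : ℝ} (hτ : 0 ≤ τ) (hρ : 0 ≤ ρ)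
    {N : ℕ} (e : ℕ → W) (hM : ∀ j ≤ N, ‖ι (e j)‖ ≤ M)
    (he : ∀ m, m + q ≤ N → ∀ w,
      k (∑ i : Fin (q + 1), α i • ι (e (m + i))) (ι w) + τ * b (e (m + q)) w ≤ ρ * ‖ι w‖)
    (m : ℕ) (hm : m + q ≤ N) :
    μ.ε * k (ι (e (m + q))) (ι (e (m + q))) ≤
      gramForm k μ.G (fun i => ι (e i)) + τ * gramForm b μ.K (fun i => e i)
        + (N + 1) * (ρ * ((∑ i, |μ.ν i|) * M)) := by
  have hM0 : 0 ≤ M := (norm_nonneg _).trans (hM 0 (Nat.zero_le _))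
  have hR : 0 ≤ ρ * ((∑ i, |μ.ν i|) * M) :=
    mul_nonneg hρ (mul_nonneg (sum_nonneg fun i _ => abs_nonneg _) hM0)
  have step : ∀ m, m + q ≤ N →
      gramForm k μ.G (fun i => ι (e (m + 1 + i))) + τ * gramForm b μ.K (fun i => e (m + 1 + i))
      ≤ gramForm k μ.G (fun i => ι (e (m + i))) + τ * gramForm b μ.K (fun i => e (m + i))
        + ρ * ((∑ i, |μ.ν i|) * M) := by
    intro m hm
    have h := μ.gramForm_succ_le ι hk hk0 hb hb0 hτ (fun i => e (m + i)) (by simpa using he m hm)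
    have h' := mul_le_mul_of_nonneg_left (norm_sum_smul_le_of_forall_norm_le μ.ν
      (fun i : Fin (q + 1) => ι (e (m + i))) (fun i => hM _ (by omega))) hρ
    simp only [Fin.val_succ, Fin.val_castSucc] at h
    simp only [add_assoc, add_comm 1] at h h' ⊢
    linarith
  -- The window starting at m ends at m + q - 1, hence the bound N + 1: the last window may end at
  -- N.
  have key : ∀ m, m + q ≤ N + 1 →
      gramForm k μ.G (fun i => ι (e (m + i))) + τ * gramForm b μ.K (fun i => e (m + i))
      ≤ gramForm k μ.G (fun i => ι (e i)) + τ * gramForm b μ.K (fun i => e i)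
        + m * (ρ * ((∑ i, |μ.ν i|) * M)) := by
    intro m
    induction m with
    | zero => simp
    | succ m ih =>
      intro hm
      have h1 := ih (by omega)
      have h2 := step m (by omega)
      push_cast
      linarith
  have h1 := key (m + 1) (by omega)
  have h2 := mul_le_gramForm hk hk0 μ.le_G (fun i => ι (e (m + i)))
  -- With ε = 0 this is nonnegativity of the final K-form, which can then be discarded.
  have h3 := mul_le_gramForm (ε := 0) hb hb0 (by simpa using μ.K_nonneg) (fun i => e (m + i))
  have h4 := mul_nonneg hτ (by simpa using h3)
  have h5 : ((m + 1 : ℕ) : ℝ) * (ρ * ((∑ i, |μ.ν i|) * M))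
      ≤ (N + 1) * (ρ * ((∑ i, |μ.ν i|) * M)) := by
    refine mul_le_mul_of_nonneg_right ?_ hR
    exact_mod_cast (by omega : m + 1 ≤ N + 1)
  simp only [Fin.val_succ, Fin.val_last] at h2 h4
  simp only [add_assoc, add_comm 1] at h1 h2 h4 h5 ⊢
  linarith

end Stability

/-! ### Taylor expansion and consistency. -/

section Consistency

variable {X : Type*} [NormedAddCommGroup X] [NormedSpace ℝ X]

/-- Taylor's formula on a compact interval with a remainder bound that is uniform in the base
point. -/
theorem exists_taylor_remainder_bound_uniform {T : ℝ} (hT : 0 < T) {u : ℝ → X} {n : ℕ}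
    (hu : ContDiffOn ℝ (n + 1) u (Set.Icc 0 T)) :
    ∃ C, 0 ≤ C ∧ ∀ a x, 0 ≤ a → a ≤ x → x ≤ T →
      ‖u x - ∑ k ∈ range (n + 1), ((k.factorial : ℝ)⁻¹ * (x - a) ^ k) •
        iteratedDerivWithin k u (Set.Icc 0 T) a‖ ≤ C * (x - a) ^ (n + 1) := by
  have hU := uniqueDiffOn_Icc hT
  obtain ⟨C, hC⟩ := isCompact_Icc.exists_bound_of_continuousOn
    (hu.continuousOn_iteratedDerivWithin (m := n + 1) le_rfl hU)
  have hC0 : 0 ≤ C := (norm_nonneg _).trans (hC 0 ⟨le_rfl, hT.le⟩)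
  refine ⟨C, hC0, fun a x ha hax hx => ?_⟩
  -- Taylor's formula is used on [a, T], with a as left endpoint; there the derivatives within [a,
  -- T] agree with those within [0, T]. For a = T the interval is a point and unique
  -- differentiability fails, so this case is separate.
  rcases (hax.trans hx).eq_or_lt with rfl | haT
  · obtain rfl : x = a := le_antisymm hx hax
    rw [← taylor_within_apply, taylorWithinEval_self]
    simp
  · have hsub : Set.Icc a T ⊆ Set.Icc 0 T := Set.Icc_subset_Icc_left ha
    have heq : ∀ k : ℕ, k ≤ n + 1 → ∀ y ∈ Set.Icc a T,
        iteratedDerivWithin k u (Set.Icc a T) y = iteratedDerivWithin k u (Set.Icc 0 T) y := by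
      intro k hk y hy
      rw [iteratedDerivWithin, iteratedDerivWithin, iteratedFDerivWithin_subset hsub
        (uniqueDiffOn_Icc haT) hU (hu.of_le (by exact_mod_cast hk)) hy]
    have h := taylor_mean_remainder_bound (C := C) haT.le (hu.mono hsub) ⟨hax, hx⟩
      (fun y hy => by rw [heq _ le_rfl y hy]; exact hC y (hsub hy))
    rw [taylor_within_apply] at h
    have hs : ∑ k ∈ range (n + 1), ((k.factorial : ℝ)⁻¹ * (x - a) ^ k) •
          iteratedDerivWithin k u (Set.Icc a T) a
        = ∑ k ∈ range (n + 1), ((k.factorial : ℝ)⁻¹ * (x - a) ^ k) •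
          iteratedDerivWithin k u (Set.Icc 0 T) a :=
      sum_congr rfl fun k hk => by
        rw [heq k (by have := mem_range.mp hk; omega) a ⟨le_rfl, haT.le⟩]
    rw [hs] at h
    refine h.trans (div_le_self ?_ ?_)
    · exact mul_nonneg hC0 (pow_nonneg (sub_nonneg.2 hax) _)
    · exact_mod_cast n.factorial_pos

/-- A backward difference formula of order `q` is consistent of order `q`, uniformly on
`[0, T]`. -/
theorem exists_backward_difference_bound {T : ℝ} (hT : 0 < T) {q : ℕ} (hq : 1 ≤ q)
    {α : Fin (q + 1) → ℝ}
    (hα : ∀ k ≤ q, ∑ i : Fin (q + 1), α i * ((i : ℕ) : ℝ) ^ k = k * (q : ℝ) ^ (k - 1))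
    {u : ℝ → X} (hu : ContDiffOn ℝ (q + 1) u (Set.Icc 0 T)) :
    ∃ C, 0 ≤ C ∧ ∀ a τ, 0 ≤ a → 0 ≤ τ → a + q * τ ≤ T →
      ‖∑ i : Fin (q + 1), α i • u (a + (i : ℕ) * τ)
        - τ • derivWithin u (Set.Icc 0 T) (a + q * τ)‖ ≤ C * τ ^ (q + 1) := by
  obtain ⟨r, rfl⟩ : ∃ r, q = r + 1 := ⟨q - 1, by omega⟩
  obtain ⟨C₁, hC₁, h₁⟩ := exists_taylor_remainder_bound_uniform hT hu
  -- One order less suffices for the derivative, because it enters with a factor τ.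
  have hu' : ContDiffOn ℝ (r + 1) (derivWithin u (Set.Icc 0 T)) (Set.Icc 0 T) :=
    hu.derivWithin (uniqueDiffOn_Icc hT) (by norm_cast)
  obtain ⟨C₂, hC₂, h₂⟩ := exists_taylor_remainder_bound_uniform hT hu'
  refine ⟨(∑ i, |α i|) * (C₁ * ((r + 1 : ℕ) : ℝ) ^ (r + 1 + 1)) + C₂ * ((r + 1 : ℕ) : ℝ) ^ (r + 1),
    by positivity, fun a τ ha hτ haT => ?_⟩
  set D : ℕ → X := fun k => iteratedDerivWithin k u (Set.Icc 0 T) a with hD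
  have hiτ : ∀ i : Fin (r + 1 + 1), ((i : ℕ) : ℝ) * τ ≤ ((r + 1 : ℕ) : ℝ) * τ := fun i =>
    mul_le_mul_of_nonneg_right (by exact_mod_cast Nat.lt_succ_iff.mp i.2) hτ
  have hqτ : 0 ≤ ((r + 1 : ℕ) : ℝ) * τ := by positivity
  have e₁ : ∀ i : Fin (r + 1 + 1), ‖u (a + (i : ℕ) * τ)
      - ∑ k ∈ range (r + 1 + 1), ((k.factorial : ℝ)⁻¹ * ((i : ℕ) * τ) ^ k) • D k‖
      ≤ C₁ * (((r + 1 : ℕ) : ℝ) * τ) ^ (r + 1 + 1) := fun i => by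
    have hi : 0 ≤ ((i : ℕ) : ℝ) * τ := by positivity
    have := h₁ a (a + (i : ℕ) * τ) ha (by linarith) (by linarith [hiτ i])
    rw [add_sub_cancel_left] at this
    exact this.trans (mul_le_mul_of_nonneg_left (pow_le_pow_left₀ hi (hiτ i) _) hC₁)
  have e₂ : ‖derivWithin u (Set.Icc 0 T) (a + (r + 1 : ℕ) * τ)
      - ∑ k ∈ range (r + 1), ((k.factorial : ℝ)⁻¹ * ((r + 1 : ℕ) * τ) ^ k) • D (k + 1)‖
      ≤ C₂ * (((r + 1 : ℕ) : ℝ) * τ) ^ (r + 1) := by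
    have := h₂ a (a + (r + 1 : ℕ) * τ) ha (by linarith) haT
    rw [add_sub_cancel_left] at this
    simpa only [hD, iteratedDerivWithin_succ'] using this
  have e₃ : ∑ i : Fin (r + 1 + 1), α i •
        ∑ k ∈ range (r + 1 + 1), ((k.factorial : ℝ)⁻¹ * ((i : ℕ) * τ) ^ k) • D k
      = τ • ∑ k ∈ range (r + 1), ((k.factorial : ℝ)⁻¹ * ((r + 1 : ℕ) * τ) ^ k) • D (k + 1) := by
    have : ∀ k ∈ range (r + 1 + 1),
        ∑ i : Fin (r + 1 + 1), α i • ((k.factorial : ℝ)⁻¹ * ((i : ℕ) * τ) ^ k) • D k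
        = ((k.factorial : ℝ)⁻¹ * τ ^ k * (k * ((r + 1 : ℕ) : ℝ) ^ (k - 1))) • D k := by
      intro k hk
      rw [← hα k (by have := mem_range.mp hk; omega), mul_sum, sum_smul]
      refine sum_congr rfl fun i _ => ?_
      rw [smul_smul, mul_pow]
      congr 1
      ring
    simp_rw [smul_sum]
    rw [sum_comm, sum_congr rfl this, sum_range_succ']
    -- The k = 0 term, split off above, carries the factor k and drops out; the remaining powers
    -- match the expansion of the derivative.
    simp only [Nat.cast_zero, zero_mul, mul_zero, zero_smul, add_zero, smul_smul]
    refine sum_congr rfl fun k _ => ?_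
    congr 1
    have hk : (k.factorial : ℝ) ≠ 0 := by exact_mod_cast k.factorial_ne_zero
    have hk' : ((k : ℝ) + 1) ≠ 0 := by positivity
    rw [Nat.factorial_succ, Nat.add_sub_cancel, mul_pow]
    push_cast
    field_simp
    ring
  have split : ∑ i : Fin (r + 1 + 1), α i • u (a + (i : ℕ) * τ)
        - τ • derivWithin u (Set.Icc 0 T) (a + (r + 1 : ℕ) * τ)
      = ∑ i : Fin (r + 1 + 1), α i • (u (a + (i : ℕ) * τ)
          - ∑ k ∈ range (r + 1 + 1), ((k.factorial : ℝ)⁻¹ * ((i : ℕ) * τ) ^ k) • D k)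
        - τ • (derivWithin u (Set.Icc 0 T) (a + (r + 1 : ℕ) * τ)
          - ∑ k ∈ range (r + 1), ((k.factorial : ℝ)⁻¹ * ((r + 1 : ℕ) * τ) ^ k) • D (k + 1)) := by
    simp only [smul_sub, sum_sub_distrib]
    rw [e₃]
    abel
  rw [split]
  refine (norm_sub_le _ _).trans ?_
  have f₁ := norm_sum_smul_le_of_forall_norm_le α _ e₁
  have f₂ := mul_le_mul_of_nonneg_left e₂ hτ
  rw [norm_smul, Real.norm_eq_abs, abs_of_nonneg hτ]
  refine (add_le_add f₁ f₂).trans_eq ?_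
  ring

end Consistency

/-! ### The mass form and the error equation. -/

theorem ContinuousLinearMap.apply_le_of_norm_le {X Y : Type*}
    [NormedAddCommGroup X] [NormedSpace ℝ X] [NormedAddCommGroup Y] [NormedSpace ℝ Y]
    (B : X →L[ℝ] Y →L[ℝ] ℝ) {x : X} {r : ℝ} (hx : ‖x‖ ≤ r) (y : Y) :
    B x y ≤ ‖B‖ * r * ‖y‖ := by
  refine (le_abs_self _).trans ((B.le_opNorm₂ x y).trans ?_)
  gcongr

namespace EllipticParabolicSystem

variable {V W H : Type*}
  [NormedAddCommGroup V] [InnerProductSpace ℝ V] [CompleteSpace V]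
  [NormedAddCommGroup W] [InnerProductSpace ℝ W] [CompleteSpace W]
  [NormedAddCommGroup H] [InnerProductSpace ℝ H] [CompleteSpace H]
  (S : EllipticParabolicSystem V W H)

/-- The operator `𝒜⁻¹` as a continuous linear map. -/
noncomputable def opAinvL : StrongDual ℝ V →L[ℝ] V where
  toFun := S.opAinv
  map_add' φ ψ := by
    conv_lhs => rw [← S.a_opAinv φ, ← S.a_opAinv ψ, ← map_add, S.opAinv_a]
  map_smul' r φ := by
    conv_lhs => rw [← S.a_opAinv φ, ← map_smul, S.opAinv_a]
    rfl
  cont := S.a_coercive.continuousLinearEquivOfBilin.symm.continuous.comp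
    (InnerProductSpace.toDual ℝ V).symm.continuous

@[simp] theorem opAinvL_apply (φ : StrongDual ℝ V) : S.opAinvL φ = S.opAinv φ := rfl

/-- The functional `⟨𝒟 𝒜⁻¹ φ, ·⟩` on `H`. -/
noncomputable def load : StrongDual ℝ V →L[ℝ] H →L[ℝ] ℝ := S.d.comp S.opAinvL

theorem load_apply (φ : StrongDual ℝ V) (h : H) :
    S.load φ h = inner ℝ (S.opD (S.opAinv φ)) h := by
  simp [load]

/-- The bilinear form `⟨(ℳ + 𝒞) ·, ·⟩` on `H`. -/
noncomputable def massForm : H →L[ℝ] H →L[ℝ] ℝ := S.load.comp S.d.flip + S.c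

theorem massForm_apply (h w : H) : S.massForm h w = inner ℝ (S.opM h + S.opC h) w := by
  rw [inner_add_left, inner_opC, opM, ← load_apply]
  rfl

/-- This form makes both symmetry and nonnegativity of ℳ visible, as consequences of the same
properties of a. -/
theorem load_flip_apply (h w : H) :
    S.load (S.d.flip h) w = S.a (S.opAinv (S.d.flip w)) (S.opAinv (S.d.flip h)) := by
  rw [S.a_opAinv]
  rfl

theorem massForm_symm (h w : H) : S.massForm h w = S.massForm w h := by
  change S.load (S.d.flip h) w + S.c h w = S.load (S.d.flip w) h + S.c w h
  rw [load_flip_apply, load_flip_apply, S.a_symm, S.c_symm]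

theorem c_self_le_massForm (h : H) : S.c h h ≤ S.massForm h h := by
  change S.c h h ≤ S.load (S.d.flip h) h + S.c h h
  rw [load_flip_apply]
  obtain ⟨κ, hκ, ha⟩ := S.a_coercive
  have := ha (S.opAinv (S.d.flip h))
  have : 0 ≤ κ * ‖S.opAinv (S.d.flip h)‖ * ‖S.opAinv (S.d.flip h)‖ := by positivity
  linarith

/-- The error of the fully implicit scheme satisfies the scheme with a right-hand side of
order `τ ^ (q + 1)`. -/
theorem exists_error_equation_bound {q : ℕ} (hq : q = 4 ∨ q = 5 ∨ q = 6) {T : ℝ} (hT : 0 < T)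
    {f : ℝ → StrongDual ℝ V} {g : ℝ → StrongDual ℝ W} {p : ℝ → W} (hsol : S.IsSolution T f g p)
    (hp : ContDiffOn ℝ (q + 1) (fun t => S.ι (p t)) (Set.Icc 0 T))
    (hf : ContDiffOn ℝ (q + 1) f (Set.Icc 0 T)) :
    ∃ R, 0 ≤ R ∧ ∀ (N : ℕ) (τ : ℝ) (P : ℕ → W), 0 < τ → N * τ ≤ T →
      S.IsImplicitBDF q N τ f g P → ∀ m, m + q ≤ N → ∀ w,
        S.massForm (∑ i : Fin (q + 1), bdfWeight q i •
            S.ι (p ((m + i : ℕ) * τ) - P (m + i))) (S.ι w)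
          + τ * S.b (p ((m + q : ℕ) * τ) - P (m + q)) w ≤ R * τ ^ (q + 1) * ‖S.ι w‖ := by
  have hq1 : 1 ≤ q := by omega
  obtain ⟨C₁, hC₁, h₁⟩ := exists_backward_difference_bound hT hq1
    (fun k hk => sum_bdfWeight_mul_pow hq hk) hp
  obtain ⟨C₂, hC₂, h₂⟩ := exists_backward_difference_bound hT hq1
    (fun k hk => sum_bdfWeight_mul_pow hq hk) hf
  refine ⟨‖S.massForm‖ * C₁ + ‖S.load‖ * C₂, by positivity, fun N τ P hτ hN hP m hm w => ?_⟩
  have hle : ((m + q : ℕ) : ℝ) * τ ≤ T :=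
    (mul_le_mul_of_nonneg_right (by exact_mod_cast hm) hτ.le).trans hN
  -- The differential equation is available only on (0, T]; q ≥ 1 keeps the node away from 0.
  have hpos : 0 < ((m + q : ℕ) : ℝ) * τ := mul_pos (by exact_mod_cast (by omega)) hτ
  have hnode : ∀ i : ℕ, (m : ℝ) * τ + i * τ = ((m + i : ℕ) : ℝ) * τ := fun i => by
    push_cast; ring
  have b₁ := h₁ (m * τ) τ (by positivity) hτ.le (by rw [hnode]; exact hle)
  have b₂ := h₂ (m * τ) τ (by positivity) hτ.le (by rw [hnode]; exact hle)
  simp only [hnode] at b₁ b₂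
  have eqp := DFunLike.congr_fun (hsol.2.2 _ ⟨hpos, hle⟩) w
  have eqP := DFunLike.congr_fun (hP (m + q) (by omega) hm) w
  simp only [Nat.add_sub_cancel, Finset.sum_range] at eqP
  simp only [add_apply, sub_apply,
    smul_apply, toWDual_apply, ← massForm_apply, ← load_apply, opB,
    smul_eq_mul] at eqp eqP
  set p' := derivWithin (fun s => S.ι (p s)) (Set.Icc 0 T) (((m + q : ℕ) : ℝ) * τ)
  set f' := derivWithin f (Set.Icc 0 T) (((m + q : ℕ) : ℝ) * τ)
  have key : S.massForm (∑ i : Fin (q + 1), bdfWeight q i •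
            S.ι (p ((m + i : ℕ) * τ) - P (m + i))) (S.ι w)
          + τ * S.b (p ((m + q : ℕ) * τ) - P (m + q)) w
      = S.massForm (∑ i : Fin (q + 1), bdfWeight q i • S.ι (p ((m + i : ℕ) * τ)) - τ • p') (S.ι w)
        + S.load (∑ i : Fin (q + 1), bdfWeight q i • f ((m + i : ℕ) * τ) - τ • f') (S.ι w) := by
    simp only [bdfWeight, map_sub, smul_sub, sum_sub_distrib, sub_apply,
      map_smul, smul_apply, smul_eq_mul] at eqP ⊢
    -- Both equations evaluate g and ℬ at the same node, so g cancels and only the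
    -- difference-quotient defects of p and f remain, both paired in H.
    linear_combination τ * eqp - eqP
  rw [key]
  have c₁ := S.massForm.apply_le_of_norm_le b₁ (S.ι w)
  have c₂ := S.load.apply_le_of_norm_le b₂ (S.ι w)
  refine (add_le_add c₁ c₂).trans_eq ?_
  ring

end EllipticParabolicSystem

/-! ### Starting values and conclusion. -/

theorem gramForm_le_of_forall_le {E : Type*} [AddCommGroup E] [Module ℝ E]
    {B : E →ₗ[ℝ] E →ₗ[ℝ] ℝ} {n : ℕ} {G : Fin n → Fin n → ℝ} {u : Fin n → E} {r : ℝ}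
    (h : ∀ i j, G i j ≠ 0 → |B (u i) (u j)| ≤ r) :
    gramForm B G u ≤ (∑ i, ∑ j, |G i j|) * r := by
  rw [gramForm, sum_mul]
  refine sum_le_sum fun i _ => ?_
  rw [sum_mul]
  refine sum_le_sum fun j _ => ?_
  rcases eq_or_ne (G i j) 0 with h0 | h0
  · simp [h0]
  · refine (le_abs_self _).trans ?_
    rw [abs_mul]
    exact mul_le_mul_of_nonneg_left (h i j h0) (abs_nonneg _)

/-- If M > s, then s² ≤ sM, and dividing the hypothesis by M gives cM ≤ (A + D)s; the summand 1
covers M ≤ s. -/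
theorem le_mul_of_mul_sq_le {c A D s M : ℝ} (hc : 0 < c) (hA : 0 ≤ A) (hD : 0 ≤ D) (hs : 0 < s)
    (hM : c * M ^ 2 ≤ A * s ^ 2 + D * s * M) : M ≤ (1 + (A + D) / c) * s := by
  by_contra! hlt
  have hX : 0 ≤ (A + D) / c := by positivity
  have hsM : s < M := by nlinarith
  have h1 : (c + (A + D)) * s < c * M := by
    have := mul_lt_mul_of_pos_left hlt hc
    have h2 : c * ((1 + (A + D) / c) * s) = (c + (A + D)) * s := by field_simp
    linarith
  have h2 : (c + (A + D)) * s * M < c * M * M := mul_lt_mul_of_pos_right h1 (by linarith)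
  have h3 : A * s * s ≤ A * s * M := mul_le_mul_of_nonneg_left hsM.le (by positivity)
  have h4 : 0 < c * s * M := by have := hs.trans hsM; positivity
  nlinarith

theorem theorem7p1
    {V W H : Type*}
    [NormedAddCommGroup V] [InnerProductSpace ℝ V] [CompleteSpace V]
    [NormedAddCommGroup W] [InnerProductSpace ℝ W] [CompleteSpace W]
    [NormedAddCommGroup H] [InnerProductSpace ℝ H] [CompleteSpace H]
    (S : EllipticParabolicSystem V W H)
    (q : ℕ) (hq : q = 4 ∨ q = 5 ∨ q = 6)
    (T : ℝ) (hT : 0 < T)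
    (f : ℝ → StrongDual ℝ V) (g : ℝ → StrongDual ℝ W) (p : ℝ → W)
    (hsol : S.IsSolution T f g p)
    (hp : ContDiffOn ℝ (q + 1) (fun t => S.ι (p t)) (Set.Icc 0 T))
    (hf : ContDiffOn ℝ (q + 1) f (Set.Icc 0 T))
    (C₀ : ℝ) :
    ∃ C : ℝ, 0 < C ∧ ∀ (N : ℕ) (τ : ℝ) (P : ℕ → W), q ≤ N → τ = T / N →
      S.IsImplicitBDF q N τ f g P →
      (∀ j : ℕ, j < q → ‖S.ι (p (j * τ) - P j)‖ ≤ C₀ * τ ^ q) →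
      (∀ j : ℕ, 3 ≤ j → j < q → Real.sqrt τ * ‖p (j * τ) - P j‖ ≤ C₀ * τ ^ q) →
      ∀ n : ℕ, q ≤ n → n ≤ N → ‖S.ι (p (n * τ) - P n)‖ ≤ C * τ ^ q := by
  obtain ⟨μ⟩ := nonempty_energyMultiplier hq
  obtain ⟨R, hR, hR'⟩ := S.exists_error_equation_bound hq hT hsol hp hf
  obtain ⟨κ, hκ, hc⟩ := S.c_coercive
  have hμ := μ.ε_pos
  set Λ := ∑ i, |μ.ν i| with hΛ
  have hΛ0 : 0 ≤ Λ := sum_nonneg fun i _ => abs_nonneg _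
  set A := (∑ i, ∑ j, |μ.G i j|) * (‖S.massForm‖ * C₀ ^ 2)
    + (∑ i, ∑ j, |μ.K i j|) * (‖S.b‖ * C₀ ^ 2) with hA
  have hA0 : 0 ≤ A := by positivity
  set D := 2 * T * R * Λ with hD
  have hD0 : 0 ≤ D := by positivity
  -- A comes from the starting values, D from the accumulated residuals; |C₀| covers the case that
  -- the largest error is a starting error.
  refine ⟨1 + (A + D) / (μ.ε * κ) + |C₀|, by positivity, ?_⟩
  intro N τ P hqN hτN hP hstart hstartW
  have hN : (0 : ℝ) < N := by exact_mod_cast (by omega : 0 < N)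
  have hτ : 0 < τ := hτN ▸ div_pos hT hN
  have hNτ : N * τ = T := by rw [hτN]; field_simp
  set e : ℕ → W := fun j => p (j * τ) - P j with he
  have hs : 0 < τ ^ q := pow_pos hτ q
  obtain ⟨j, hj, hmax⟩ := exists_max_image (range (N + 1)) (fun j => ‖S.ι (e j)‖) ⟨0, by simp⟩
  have hjN : j ≤ N := Nat.lt_succ_iff.mp (mem_range.mp hj)
  suffices hbound : ‖S.ι (e j)‖ ≤ (1 + (A + D) / (μ.ε * κ) + |C₀|) * τ ^ q from
    fun n _ hn => (hmax n (mem_range.mpr (by omega))).trans hbound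
  rcases lt_or_ge j q with hjq | hjq
  · refine (hstart j hjq).trans (mul_le_mul_of_nonneg_right ?_ hs.le)
    have : 0 ≤ (A + D) / (μ.ε * κ) := by positivity
    linarith [le_abs_self C₀]
  obtain ⟨m, rfl⟩ : ∃ m, j = m + q := ⟨j - q, by omega⟩
  have energy := μ.energy_le (k := S.massForm.toLinearMap₁₂) (b := S.b.toLinearMap₁₂)
    (τ := τ) (ρ := R * τ ^ (q + 1)) (M := ‖S.ι (e (m + q))‖) (N := N) (S.ι : W →ₗ[ℝ] H)
    S.massForm_symm
    (fun x => by
      have : 0 ≤ κ * ‖x‖ * ‖x‖ := by positivity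
      exact this.trans ((hc x).trans (S.c_self_le_massForm x)))
    S.b_symm
    (fun x => by
      obtain ⟨β, hβ, hb⟩ := S.b_coercive
      have : 0 ≤ β * ‖x‖ * ‖x‖ := by positivity
      exact this.trans (hb x))
    hτ.le (by positivity) e
    (fun i hi => hmax i (mem_range.mpr (by omega)))
    (fun i hi w => hR' N τ P hτ hNτ.le hP i hi w) m hjN
  have hG : gramForm S.massForm.toLinearMap₁₂ μ.G (fun i => S.ι (e i))
      ≤ (∑ i, ∑ j, |μ.G i j|) * (‖S.massForm‖ * C₀ ^ 2 * (τ ^ q) ^ 2) :=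
    gramForm_le_of_forall_le fun i j _ => by
      refine (S.massForm.le_opNorm₂ _ _).trans ?_
      calc ‖S.massForm‖ * ‖S.ι (e i)‖ * ‖S.ι (e j)‖
          ≤ ‖S.massForm‖ * (C₀ * τ ^ q) * (C₀ * τ ^ q) := by
            have h0 := (norm_nonneg _).trans (hstart i i.2)
            have h1 := hstart i i.2
            have h2 := hstart j j.2
            gcongr
        _ = _ := by ring
  have hK : τ * gramForm S.b.toLinearMap₁₂ μ.K (fun i => e i)
      ≤ (∑ i, ∑ j, |μ.K i j|) * (‖S.b‖ * C₀ ^ 2 * (τ ^ q) ^ 2) := by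
    -- The factor τ is put into the form and split as √τ · √τ, one for each W-norm; `K_support`
    -- restricts this to the indices where the W-bound is assumed.
    have := gramForm_le_of_forall_le (B := τ • S.b.toLinearMap₁₂) (G := μ.K)
      (u := fun i => e i) (r := ‖S.b‖ * C₀ ^ 2 * (τ ^ q) ^ 2) fun i j hij => by
        obtain ⟨hi, hj⟩ := μ.K_support i j hij
        have h1 := hstartW i hi i.2
        have h2 := hstartW j hj j.2
        have h0 : 0 ≤ C₀ * τ ^ q := le_trans (by positivity) h1
        have hb := S.b.le_opNorm₂ (e i) (e j)
        calc |τ * S.b (e i) (e j)| = τ * |S.b (e i) (e j)| := by rw [abs_mul, abs_of_pos hτ]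
          _ ≤ τ * (‖S.b‖ * ‖e i‖ * ‖e j‖) := mul_le_mul_of_nonneg_left hb hτ.le
          _ = ‖S.b‖ * (√τ * ‖e i‖) * (√τ * ‖e j‖) := by
            nth_rewrite 1 [← Real.mul_self_sqrt hτ.le]
            ring
          _ ≤ ‖S.b‖ * (C₀ * τ ^ q) * (C₀ * τ ^ q) := by gcongr
          _ = _ := by ring
    refine le_trans (le_of_eq ?_) this
    simp only [gramForm, mul_sum, LinearMap.smul_apply, smul_eq_mul]
    exact sum_congr rfl fun i _ => sum_congr rfl fun j _ => by ring
  set M := ‖S.ι (e (m + q))‖ with hM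
  have hlow : μ.ε * κ * M ^ 2 ≤ μ.ε * S.massForm (S.ι (e (m + q))) (S.ι (e (m + q))) := by
    have := mul_le_mul_of_nonneg_left ((hc _).trans (S.c_self_le_massForm (S.ι (e (m + q))))) hμ.le
    refine le_trans (le_of_eq ?_) this
    ring
  have hrhs : ((N : ℝ) + 1) * (R * τ ^ (q + 1) * (Λ * M)) ≤ D * τ ^ q * M := by
    -- About N residuals of size τ^{q+1} add up to order τ^q.
    have h1 : ((N : ℝ) + 1) * τ ≤ 2 * T := by
      have : (1 : ℝ) ≤ N := by exact_mod_cast (by omega : 1 ≤ N)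
      nlinarith
    calc ((N : ℝ) + 1) * (R * τ ^ (q + 1) * (Λ * M))
        = ((N + 1) * τ) * (R * τ ^ q * (Λ * M)) := by ring
      _ ≤ (2 * T) * (R * τ ^ q * (Λ * M)) := mul_le_mul_of_nonneg_right h1 (by positivity)
      _ = _ := by ring
  have hfin : M ≤ (1 + (A + D) / (μ.ε * κ)) * τ ^ q := by
    refine le_mul_of_mul_sq_le (by positivity) hA0 hD0 hs (hlow.trans (energy.trans ?_))
    refine (add_le_add (add_le_add hG hK) hrhs).trans_eq ?_
    rw [hA]
    ring
  refine hfin.trans (mul_le_mul_of_nonneg_right ?_ hs.le)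
  linarith [abs_nonneg C₀]
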